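/- **Setting.** Let $\Omega\subset\mathbb R^n$ be a bounded Lipschitz domain with a finite partition $\mathcal T_h$ into non-overlapping Lipschitz subdomains $K$. On $L^2\Lambda(K)$, the square-integrable differential forms of all degrees, let $d$, $\delta$ be the exterior differential and the codifferential (in the sense of distributions) and $D=d+\delta$. For $w\in H\Lambda(K)\cap H^*\Lambda(K)$ (i.e. $w,dw,\delta w\in L^2$) let $w^{\tan}$ and $w^{\rm nor}$ be the weak tangential and normal traces on $\partial K$ (the pullback to $\partial K$ and the contraction with the outer unit normal, if $w$ is smooth). For each $K$ let - $W_h(K)\subset H\Lambda(K)\cap H^*\Lambda(K)$ be a subspace whose elements have traces $w^{\tan},w^{\rm nor}\in L^2\Lambda(\partial K)$, with the graph norm (if $\dim W_h(K)<\infty$ the choice of norm is irrelevant), - $\widehat W_h^{\rm nor}(\partial K),\ \widehat W_h^{\tan}(\partial K)\subset L^2\Lambda(\partial K)$ be subspaces, and let $W_h,\widehat W_h^{\rm nor},\widehat W_h^{\tan}$ be the products over $K\in\mathcal T_h$. Let $\widehat V_h^{\tan}\subset\widehat W_h^{\tan}$ be the subspace of those elements that are single-valued on all interior interfaces $\partial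 K\cap\partial K'$ (off $\partial\Omega$), and $\mathring V_h^{\tan}\subset\widehat V_h^{\tan}$ the subspace of those that also vanish on $\partial\Omega$. Bold letters denote tensor products with $\mathbb R^2$, whose elements are written $(q,p)$; $\mathbf J(q,p)=(-p,q)$ and $\mathbf D(q,p)=(Dq,Dp)$. Write $(\cdot,\cdot)_{\mathcal T_h}=\sum_K(\cdot,\cdot)_{K}$ and $\langle\cdot,\cdot\rangle_{\partial\mathcal T_h}=\sum_K\langle\cdot,\cdot\rangle_{\partial K}$ for the $L^2$ inner products, and $$[\mathbf w_1,\mathbf w_2]_{\partial K}=\langle \mathbf w_1^{\tan},\mathbf w_2^{\rm nor}\rangle_{\partial K}-\langle \mathbf w_2^{\tan},\mathbf w_1^{\rm nor}\rangle_{\partial K},\qquad [\cdot,\cdot]_{\partial\mathcal T_h}=\sum_K[\cdot,\cdot]_{\partial K}.$$ Let $\mathbf\Phi=\prod_K\mathbf\Phi_K$ with bounded linear maps $\mathbf\Phi_K:\mathbf W_h(K)\times\widehat{\mathbf W}_h^{\rm nor}(\partial K)\times\widehat{\mathbf W}_h^{\tan}(\partial K)\to\mathbf L^2\mathbf\Lambda(\partial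 K)$ (the local flux function), let $I$ be a time interval, and let $\mathbf f=\prod_K\mathbf f_K$, $\mathbf f_K:I\times\mathbf W_h(K)\to\mathbf L^2\mathbf\Lambda(K)$, be $C^1$ in $\mathbf z_h$. Consider the semidiscrete equations for $\mathbf z_h\in\mathbf W_h$ and $\widehat{\mathbf z}_h=(\widehat{\mathbf z}_h^{\rm nor},\widehat{\mathbf z}_h^{\tan})\in\widehat{\mathbf W}_h^{\rm nor}\times\widehat{\mathbf V}_h^{\tan}$: $$\begin{aligned} \text{(1)}\quad &(\mathbf J\dot{\mathbf z}_h,\mathbf w_h)_{\mathcal T_h}+(\mathbf z_h,\mathbf D\mathbf w_h)_{\mathcal T_h}+[\widehat{\mathbf z}_h,\mathbf w_h]_{\partial\mathcal T_h}=(\mathbf f(t,\mathbf z_h),\mathbf w_h)_{\mathcal T_h}&&\forall\,\mathbf w_h\in\mathbf W_h,\\ \text{(2)}\quad &\langle\mathbf\Phi(\mathbf z_h,\widehat{\mathbf z}_h),\widehat{\mathbf w}_h^{\rm nor}\rangle_{\partial\mathcal T_h}=0&&\forall\,\widehat{\mathbf w}_h^{\rm nor}\in\widehat{\mathbf W}_h^{\rm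 nor},\\ \text{(3)}\quad &\langle\widehat{\mathbf z}_h^{\rm nor},\widehat{\mathbf w}_h^{\tan}\rangle_{\partial\mathcal T_h}=0&&\forall\,\widehat{\mathbf w}_h^{\tan}\in\mathring{\mathbf V}_h^{\tan}. \end{aligned}$$ The flux $\mathbf\Phi$ is *multisymplectic* if $[\widehat{\mathbf w}_1-\mathbf w_1,\widehat{\mathbf w}_2-\mathbf w_2]_{\partial K}=0$ for every $K\in\mathcal T_h$ whenever $(\mathbf w_1,\widehat{\mathbf w}_1)$ and $(\mathbf w_2,\widehat{\mathbf w}_2)$ in $\mathbf W_h\times\widehat{\mathbf W}_h^{\rm nor}\times\widehat{\mathbf V}_h^{\tan}$ both satisfy (2). The derivative $\partial\mathbf f/\partial\mathbf z_h$ is *symmetric* if $(\frac{\partial\mathbf f}{\partial\mathbf z_h}\mathbf w_1,\mathbf w_2)_{\mathcal T_h}=(\frac{\partial\mathbf f}{\partial\mathbf z_h}\mathbf w_2,\mathbf w_1)_{\mathcal T_h}$ for all $\mathbf w_1,\mathbf w_2\in\mathbf W_h$, at every $(t,\mathbf z_h)\in I\times\mathbf W_h$. **Reduction assumption.** Let $\widetilde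 W_h$ be a real Hilbert space (for instance, a finite-dimensional inner product space), $\widetilde{\mathbf W}_h=\widetilde W_h\otimes\mathbb R^2$ with $\widetilde{\mathbf J}(q,p)=(-p,q)$, and let $$\mathbf\Theta:I\times\widetilde{\mathbf W}_h\to\mathbf W_h\times\widehat{\mathbf W}_h^{\rm nor}\times\mathring{\mathbf V}_h^{\tan},\qquad(t,\widetilde{\mathbf z}_h)\mapsto(\mathbf z_h,\widehat{\mathbf z}_h),$$ be $C^1$ in $\widetilde{\mathbf z}_h$, with $C^2$ component $\widetilde{\mathbf z}_h\mapsto\mathbf z_h$, such that for all $t\in I$: - (a) $\widetilde{\mathbf z}_h\mapsto\mathbf z_h$ does not depend on $t$ and is symplectic: $(\mathbf J\mathbf w_1,\mathbf w_2)_{\mathcal T_h}=(\widetilde{\mathbf J}\widetilde{\mathbf w}_1,\widetilde{\mathbf w}_2)$ for all $\widetilde{\mathbf w}_1,\widetilde{\mathbf w}_2\in\widetilde{\mathbf W}_h$, where $\mathbf w_i=\frac{\partial\mathbf z_h}{\partial\widetilde{\mathbf z}_h}\widetilde{\mathbf w}_i$; - (b) if $\dot{\widetilde{\mathbf z}}_h\in\widetilde{\mathbf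 W}_h$ is such that the equation in (1), with $\dot{\mathbf z}_h=\frac{\partial\mathbf z_h}{\partial\widetilde{\mathbf z}_h}\dot{\widetilde{\mathbf z}}_h$, holds for all test functions of the form $\mathbf w_h=\frac{\partial\mathbf z_h}{\partial\widetilde{\mathbf z}_h}\widetilde{\mathbf w}_h$, $\widetilde{\mathbf w}_h\in\widetilde{\mathbf W}_h$, then it holds for all $\mathbf w_h\in\mathbf W_h$; - (c) (2) and (3) hold for $(\mathbf z_h,\widehat{\mathbf z}_h)=\mathbf\Theta(t,\widetilde{\mathbf z}_h)$, for every $\widetilde{\mathbf z}_h\in\widetilde{\mathbf W}_h$. The reduced vector field $\widetilde{\mathbf f}:I\times\widetilde{\mathbf W}_h\to\widetilde{\mathbf W}_h$ is defined by $$(\widetilde{\mathbf f}(t,\widetilde{\mathbf z}_h),\widetilde{\mathbf w}_h)=(\mathbf f(t,\mathbf z_h),\mathbf w_h)_{\mathcal T_h}-(\mathbf z_h,\mathbf D\mathbf w_h)_{\mathcal T_h}-[\widehat{\mathbf z}_h,\mathbf w_h]_{\partial\mathcal T_h}\qquad\forall\,\widetilde{\mathbf w}_h\in\widetilde{\mathbf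 W}_h,$$ with $(\mathbf z_h,\widehat{\mathbf z}_h)=\mathbf\Theta(t,\widetilde{\mathbf z}_h)$ and $\mathbf w_h=\frac{\partial\mathbf z_h}{\partial\widetilde{\mathbf z}_h}\widetilde{\mathbf w}_h$. **Theorem.** Under the reduction assumption, suppose that $\mathbf\Phi$ is multisymplectic and $\partial\mathbf f/\partial\mathbf z_h$ is symmetric. Then for every $t\in I$ the map $\widetilde{\mathbf f}(t,\cdot)$ is $C^1$ and its Jacobian $\partial\widetilde{\mathbf f}/\partial\widetilde{\mathbf z}_h$ is symmetric at every point of $\widetilde{\mathbf W}_h$. Consequently the reduced semidiscrete ODE $\widetilde{\mathbf J}\dot{\widetilde{\mathbf z}}_h=\widetilde{\mathbf f}(t,\widetilde{\mathbf z}_h)$ is symplectic: along any solution $\widetilde{\mathbf z}_h$ on a subinterval of $I$, any two solutions $\widetilde{\mathbf w}_1,\widetilde{\mathbf w}_2$ of the variational equation $\widetilde{\mathbf J}\dot{\widetilde{\mathbf w}}_i=\frac{\partial\widetilde{\mathbf f}}{\partial\widetilde{\mathbf z}_h}\widetilde{\mathbf w}_i$ satisfy $\frac{d}{dt}(\widetilde{\mathbf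 J}\widetilde{\mathbf w}_1,\widetilde{\mathbf w}_2)=0$. -/

import Mathlib

open MeasureTheory Set Filter Topology
open scoped ContDiff InnerProductSpace

noncomputable section

namespace HybridFEEC

/-! ### Exterior algebra of `ℝⁿ` -/

/-- Euclidean space `ℝⁿ`. -/
abbrev Euc (n : ℕ) : Type := EuclideanSpace ℝ (Fin n)

/-- The standard basis vectors of `ℝⁿ`. -/
def stdVec {n : ℕ} (j : Fin n) : Euc n := EuclideanSpace.single j (1 : ℝ)

/-- `Alt ℝⁿ = ⨁_{k = 0}^{n} Alt^k ℝⁿ`. -/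
def AltR (n : ℕ) : Type := (k : Fin (n + 1)) → (Euc n) [⋀^Fin (k : ℕ)]→L[ℝ] ℝ

instance instAddCommGroupAltR (n : ℕ) : AddCommGroup (AltR n) :=
  inferInstanceAs (AddCommGroup ((k : Fin (n + 1)) → (Euc n) [⋀^Fin (k : ℕ)]→L[ℝ] ℝ))

instance instModuleAltR (n : ℕ) : Module ℝ (AltR n) :=
  inferInstanceAs (Module ℝ ((k : Fin (n + 1)) → (Euc n) [⋀^Fin (k : ℕ)]→L[ℝ] ℝ))

/-- The inner product on `Alt ℝⁿ` induced by the Euclidean one: different degrees are orthogonal and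
`(a, b) = (1 / k!) ∑_{i₁, …, i_k} a(e_{i₁}, …, e_{i_k}) b(e_{i₁}, …, e_{i_k})` in degree `k`, so that
the forms `dx^{i₁} ∧ ⋯ ∧ dx^{i_k}` with `i₁ < ⋯ < i_k` are orthonormal. -/
def altInner {n : ℕ} (a b : AltR n) : ℝ :=
  ∑ k : Fin (n + 1), (Nat.factorial k : ℝ)⁻¹ *
    ∑ s : Fin (k : ℕ) → Fin n, a k (fun j => stdVec (s j)) * b k (fun j => stdVec (s j))

theorem altInner_self_eq_zero {n : ℕ} (a : AltR n) (h : altInner a a = 0) : a = 0 := by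
  unfold altInner at h
  have hnn : ∀ k : Fin (n + 1), 0 ≤ (Nat.factorial k : ℝ)⁻¹ *
      ∑ s : Fin (k : ℕ) → Fin n, a k (fun j => stdVec (s j)) * a k (fun j => stdVec (s j)) :=
    fun k => mul_nonneg (by positivity) (Finset.sum_nonneg fun s _ => mul_self_nonneg _)
  rw [Finset.sum_eq_zero_iff_of_nonneg (fun k _ => hnn k)] at h
  funext k
  have hk := h k (Finset.mem_univ k)
  have hne : (Nat.factorial k : ℝ)⁻¹ ≠ 0 := inv_ne_zero (by exact_mod_cast Nat.factorial_ne_zero _)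
  have hs := (mul_eq_zero.mp hk).resolve_left hne
  rw [Finset.sum_eq_zero_iff_of_nonneg (fun s _ => mul_self_nonneg _)] at hs
  have h0 : (a k).toAlternatingMap = 0 := by
    refine Module.Basis.ext_alternating (EuclideanSpace.basisFun (Fin n) ℝ).toBasis ?_
    intro s _
    have := mul_self_eq_zero.mp (hs s (Finset.mem_univ s))
    simpa [stdVec] using this
  exact ContinuousAlternatingMap.toAlternatingMap_injective h0

abbrev coreAltR (n : ℕ) : InnerProductSpace.Core ℝ (AltR n) where
  inner a b := altInner a b
  conj_inner_symm a b := by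
    simp only [altInner, conj_trivial]
    exact Finset.sum_congr rfl fun k _ => by
      congr 1
      exact Finset.sum_congr rfl fun s _ => mul_comm _ _
  re_inner_nonneg a := by
    simp only [altInner, RCLike.re_to_real]
    exact Finset.sum_nonneg fun k _ =>
      mul_nonneg (by positivity) (Finset.sum_nonneg fun s _ => mul_self_nonneg _)
  add_left a b c := by
    simp only [altInner]
    rw [← Finset.sum_add_distrib]
    refine Finset.sum_congr rfl fun k _ => ?_
    rw [← mul_add, ← Finset.sum_add_distrib]
    congr 1
    exact Finset.sum_congr rfl fun s _ => add_mul _ _ _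
  smul_left a b r := by
    simp only [altInner, conj_trivial]
    rw [Finset.mul_sum]
    refine Finset.sum_congr rfl fun k _ => ?_
    rw [mul_left_comm r]
    congr 1
    rw [Finset.mul_sum]
    exact Finset.sum_congr rfl fun s _ => mul_assoc r _ _
  definite a h := altInner_self_eq_zero a h

instance instNormedAddCommGroupAltR (n : ℕ) : NormedAddCommGroup (AltR n) :=
  InnerProductSpace.Core.toNormedAddCommGroup (𝕜 := ℝ) (cd := coreAltR n)

instance instInnerProductSpaceAltR (n : ℕ) : InnerProductSpace ℝ (AltR n) :=
  InnerProductSpace.ofCore (coreAltR n).toCore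

/-- Interior product `ι_v a`. -/
def contract {n : ℕ} (v : Euc n) (a : AltR n) : AltR n := fun k =>
  if h : (k : ℕ) + 1 < n + 1 then (a ⟨(k : ℕ) + 1, h⟩).curryLeft v else 0

/-- For a unit vector `ν`: the pullback of a form along the orthogonal projection
`x ↦ x - ⟪ν, x⟫ ν` onto the hyperplane `ν^⊥`. -/
def tangential {n : ℕ} (ν : Euc n) (a : AltR n) : AltR n := fun k =>
  (a k).compContinuousLinearMap
    (ContinuousLinearMap.id ℝ (Euc n) - (innerSL ℝ ν).smulRight ν)

theorem contract_add {n : ℕ} (v : Euc n) (a b : AltR n) :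
    contract v (a + b) = contract v a + contract v b := by
  funext k
  change contract v (a + b) k = contract v a k + contract v b k
  unfold contract
  split_ifs with h
  · rfl
  · simp

theorem contract_smul {n : ℕ} (v : Euc n) (c : ℝ) (a : AltR n) :
    contract v (c • a) = c • contract v a := by
  funext k
  change contract v (c • a) k = c • contract v a k
  unfold contract
  split_ifs with h
  · rfl
  · simp

/-! ### Smooth differential forms -/

/-- `φ` is a smooth differential form (of mixed degree) on `ℝⁿ`. -/
def SmoothForm {n : ℕ} (φ : Euc n → AltR n) : Prop :=
  ∀ k : Fin (n + 1), ContDiff ℝ ∞ (fun x => φ x k)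

/-- The exterior differential `d`. -/
def extD {n : ℕ} (φ : Euc n → AltR n) (x : Euc n) : AltR n
  | ⟨0, _⟩ => 0
  | ⟨k + 1, h⟩ => extDeriv (fun y => φ y ⟨k, Nat.lt_of_succ_lt h⟩) x

/-- The codifferential `δ φ = - ∑ j, ι_{e_j} ∂_j φ`. -/
def coD {n : ℕ} (φ : Euc n → AltR n) (x : Euc n) : AltR n := fun k =>
  if h : (k : ℕ) + 1 < n + 1 then
    - ∑ j : Fin n, (fderiv ℝ (fun y => φ y ⟨(k : ℕ) + 1, h⟩) x (stdVec j)).curryLeft (stdVec j)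
  else 0

/-! ### Lipschitz domains, surface measure, outer normal -/

/-- `K` is a bounded open set with Lipschitz boundary: near each boundary point, for some unit vector
`e`, it is the region above the graph of a Lipschitz function of the coordinates orthogonal to `e`. -/
structure IsLipschitzDomain {n : ℕ} (K : Set (Euc n)) : Prop where
  isOpen : IsOpen K
  bounded : Bornology.IsBounded K
  graph : ∀ x ∈ frontier K, ∃ (e : Euc n) (g : Euc n → ℝ) (C : NNReal) (U : Set (Euc n)),
    ‖e‖ = 1 ∧ LipschitzWith C g ∧ (∀ (y : Euc n) (s : ℝ), g (y + s • e) = g y) ∧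
    U ∈ 𝓝 x ∧ ∀ y ∈ U, y ∈ K ↔ g y < ⟪e, y⟫_ℝ

/-- Surface measure on a subset `Γ` of a hypersurface of `ℝⁿ`. -/
def surf {n : ℕ} (Γ : Set (Euc n)) : Measure (Euc n) :=
  (Measure.euclideanHausdorffMeasure (n - 1)).restrict Γ

/-- `ν` is the outer unit normal of `K` at the boundary point `x`: to first order at `x`, the set `K`
is the half-space `⟪ν, y - x⟫ < 0`. -/
def IsOuterNormal {n : ℕ} (K : Set (Euc n)) (x ν : Euc n) : Prop :=
  ‖ν‖ = 1 ∧ ∀ ε > 0, ∀ᶠ y in 𝓝 x,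
    (⟪ν, y - x⟫_ℝ < -ε * ‖y - x‖ → y ∈ K) ∧ (ε * ‖y - x‖ < ⟪ν, y - x⟫_ℝ → y ∉ K)

open Classical in
/-- The outer unit normal of `K`. For a Lipschitz domain it exists at almost all boundary points; the
value at the others is immaterial. -/
def outerNormal {n : ℕ} (K : Set (Euc n)) (x : Euc n) : Euc n :=
  if h : ∃ ν, IsOuterNormal K x ν then h.choose else 0

/-! ### Square-integrable forms and traces -/

/-- `L²Λ(K)`. -/
abbrev L2Form {n : ℕ} (K : Set (Euc n)) : Type :=
  Lp (AltR n) 2 (volume.restrict K : Measure (Euc n))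

/-- `L²Λ(∂K)`: square-integrable fields `η` on `∂K` with values in the forms on the tangent space
`T_x ∂K = ν(x)^⊥`. A form on `ν^⊥` is identified with its pullback to `ℝⁿ` along the orthogonal
projection onto `ν^⊥`, i.e. with a form `a` on `ℝⁿ` such that `ι_ν a = 0`. -/
def L2Bdry {n : ℕ} (K : Set (Euc n)) : Submodule ℝ (Lp (AltR n) 2 (surf (frontier K))) where
  carrier := {η | ∀ᵐ x ∂(surf (frontier K)), contract (outerNormal K x) (η x) = 0}
  zero_mem' := by
    filter_upwards [Lp.coeFn_zero (AltR n) 2 (surf (frontier K))] with x hx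
    rw [hx]
    simpa using contract_smul (outerNormal K x) 0 (0 : AltR n)
  add_mem' := by
    intro a b ha hb
    change ∀ᵐ x ∂(surf (frontier K)), contract (outerNormal K x) ((a + b : Lp _ _ _) x) = 0
    filter_upwards [Lp.coeFn_add a b, ha, hb] with x hx h1 h2
    rw [hx, Pi.add_apply, contract_add, h1, h2, add_zero]
  smul_mem' := by
    intro c a ha
    change ∀ᵐ x ∂(surf (frontier K)), contract (outerNormal K x) ((c • a : Lp _ _ _) x) = 0
    filter_upwards [Lp.coeFn_smul c a, ha] with x hx h1
    rw [hx, Pi.smul_apply, contract_smul, h1, smul_zero]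

instance instNormedL2Bdry {n : ℕ} (K : Set (Euc n)) : NormedAddCommGroup (L2Bdry K) :=
  Submodule.normedAddCommGroup _

instance instInnerL2Bdry {n : ℕ} (K : Set (Euc n)) : InnerProductSpace ℝ (L2Bdry K) :=
  Submodule.innerProductSpace _

theorem extD_add {n : ℕ} {φ ψ : Euc n → AltR n} (hφ : SmoothForm φ) (hψ : SmoothForm ψ)
    (x : Euc n) : extD (φ + ψ) x = extD φ x + extD ψ x := by
  funext k
  change extD (φ + ψ) x k = extD φ x k + extD ψ x k
  rcases k with ⟨k, h⟩
  cases k with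
  | zero => simp [extD]
  | succ k =>
    exact extDeriv_fun_add ((hφ ⟨k, _⟩).differentiable (by simp) x)
      ((hψ ⟨k, _⟩).differentiable (by simp) x)

theorem extD_smul {n : ℕ} (c : ℝ) (φ : Euc n → AltR n) (x : Euc n) :
    extD (c • φ) x = c • extD φ x := by
  funext k
  change extD (c • φ) x k = c • extD φ x k
  rcases k with ⟨k, h⟩
  cases k with
  | zero => simp [extD]
  | succ k => exact extDeriv_fun_smul c _

/-- All triples `(φ|_K, dφ|_K, φ^tan)` with `φ` a smooth form on `ℝⁿ`, where `φ^tan` is the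
pullback of `φ` to `∂K`. -/
def smoothTan {n : ℕ} (K : Set (Euc n)) :
    Submodule ℝ (L2Form K × L2Form K × L2Bdry K) where
  carrier := {p | ∃ φ : Euc n → AltR n, SmoothForm φ ∧
    p.1 =ᵐ[volume.restrict K] φ ∧ p.2.1 =ᵐ[volume.restrict K] extD φ ∧
    (p.2.2 : Lp (AltR n) 2 (surf (frontier K))) =ᵐ[surf (frontier K)]
      fun x => tangential (outerNormal K x) (φ x)}
  zero_mem' := by
    refine ⟨0, fun k => contDiff_const (c := (0 : (Euc n) [⋀^Fin (k : ℕ)]→L[ℝ] ℝ)),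
      Lp.coeFn_zero _ _ _, ?_, ?_⟩
    · filter_upwards [Lp.coeFn_zero (AltR n) 2 (volume.restrict K)] with x hx
      have h := extD_smul 0 (0 : Euc n → AltR n) x
      rw [zero_smul, zero_smul] at h
      exact hx.trans h.symm
    · filter_upwards [Lp.coeFn_zero (AltR n) 2 (surf (frontier K))] with x hx
      refine hx.trans ?_
      funext k
      rfl
  add_mem' := by
    rintro a b ⟨φ, hφ, h1, h2, h3⟩ ⟨ψ, hψ, k1, k2, k3⟩
    refine ⟨φ + ψ, fun k => (hφ k).add (hψ k), ?_, ?_, ?_⟩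
    · exact (Lp.coeFn_add _ _).trans (h1.add k1)
    · filter_upwards [Lp.coeFn_add a.2.1 b.2.1, h2, k2] with x hx e1 e2
      refine hx.trans ?_
      rw [Pi.add_apply, e1, e2, extD_add hφ hψ]
    · filter_upwards [Lp.coeFn_add (a.2.2 : Lp (AltR n) 2 (surf (frontier K))) b.2.2, h3, k3]
        with x hx e1 e2
      refine hx.trans ?_
      rw [Pi.add_apply, e1, e2]
      rfl
  smul_mem' := by
    rintro c a ⟨φ, hφ, h1, h2, h3⟩
    refine ⟨c • φ, fun k => (hφ k).const_smul c, ?_, ?_, ?_⟩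
    · exact (Lp.coeFn_smul _ _).trans (h1.const_smul c)
    · filter_upwards [Lp.coeFn_smul c a.2.1, h2] with x hx e1
      refine hx.trans ?_
      rw [Pi.smul_apply, e1, extD_smul]
    · filter_upwards [Lp.coeFn_smul c (a.2.2 : Lp (AltR n) 2 (surf (frontier K))), h3]
        with x hx e1
      refine hx.trans ?_
      rw [Pi.smul_apply, e1]
      rfl

/-- `u = d w` in the sense of distributions on `K`: `(w, δφ)_K = (u, φ)_K` for all smooth `φ` with
compact support in `K` (`P` and `Q` are the classes of `φ` and `δφ`). -/
def IsWeakD {n : ℕ} (K : Set (Euc n)) (w u : L2Form K) : Prop :=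
  ∀ φ : Euc n → AltR n, SmoothForm φ → HasCompactSupport φ → tsupport φ ⊆ K →
    ∀ P Q : L2Form K, P =ᵐ[volume.restrict K] φ → Q =ᵐ[volume.restrict K] coD φ →
      ⟪w, Q⟫_ℝ = ⟪u, P⟫_ℝ

/-- `s = δ w` in the sense of distributions on `K`: `(w, dφ)_K = (s, φ)_K` for all smooth `φ` with
compact support in `K` (`P` and `Q` are the classes of `φ` and `dφ`). -/
def IsWeakDelta {n : ℕ} (K : Set (Euc n)) (w s : L2Form K) : Prop :=
  ∀ φ : Euc n → AltR n, SmoothForm φ → HasCompactSupport φ → tsupport φ ⊆ K →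
    ∀ P Q : L2Form K, P =ᵐ[volume.restrict K] φ → Q =ᵐ[volume.restrict K] extD φ →
      ⟪w, Q⟫_ℝ = ⟪s, P⟫_ℝ

/-- `τ ∈ L²Λ(∂K)` is the weak tangential trace of `w ∈ HΛ(K)`, `dw = u`: the extension by density
(closure) of the tangential trace of smooth forms. -/
def IsTanTrace {n : ℕ} (K : Set (Euc n)) (w u : L2Form K) (τ : L2Bdry K) : Prop :=
  (w, u, τ) ∈ (smoothTan K).topologicalClosure

/-- `η ∈ L²Λ(∂K)` is the weak normal trace of `w ∈ H^*Λ(K)`, `δw = s`: it represents the functional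
`φ^tan ↦ (dφ, w)_K - (φ, δw)_K`. For smooth `w` this is `ι_ν w`. -/
def IsNorTrace {n : ℕ} (K : Set (Euc n)) (w s : L2Form K) (η : L2Bdry K) : Prop :=
  ∀ p ∈ smoothTan K, ⟪p.2.2, η⟫_ℝ = ⟪p.2.1, w⟫_ℝ - ⟪p.1, s⟫_ℝ

/-- The space of all `w ∈ HΛ(K) ∩ H^*Λ(K)` whose tangential and normal traces lie in `L²Λ(∂K)`.
Since `w` determines `dw`, `δw` and its traces, `w` is represented by the tuple
`((w, dw, δw), (w^tan, w^nor))`; the norm is the graph norm. -/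
def TraceSpace {n : ℕ} (K : Set (Euc n)) :
    Submodule ℝ ((L2Form K × L2Form K × L2Form K) × (L2Bdry K × L2Bdry K)) where
  carrier := {p | IsWeakD K p.1.1 p.1.2.1 ∧ IsWeakDelta K p.1.1 p.1.2.2 ∧
    IsTanTrace K p.1.1 p.1.2.1 p.2.1 ∧ IsNorTrace K p.1.1 p.1.2.2 p.2.2}
  zero_mem' := by
    refine ⟨?_, ?_, ?_, ?_⟩
    · intro φ _ _ _ P Q _ _
      simp
    · intro φ _ _ _ P Q _ _
      simp
    · exact (smoothTan K).topologicalClosure.zero_mem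
    · intro p _
      simp
  add_mem' := by
    rintro a b ⟨h1, h2, h3, h4⟩ ⟨k1, k2, k3, k4⟩
    refine ⟨?_, ?_, ?_, ?_⟩
    · intro φ e1 e2 e3 P Q e4 e5
      simp only [Prod.fst_add, Prod.snd_add, inner_add_left]
      rw [h1 φ e1 e2 e3 P Q e4 e5, k1 φ e1 e2 e3 P Q e4 e5]
    · intro φ e1 e2 e3 P Q e4 e5
      simp only [Prod.fst_add, Prod.snd_add, inner_add_left]
      rw [h2 φ e1 e2 e3 P Q e4 e5, k2 φ e1 e2 e3 P Q e4 e5]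
    · exact (smoothTan K).topologicalClosure.add_mem h3 k3
    · intro p hp
      simp only [Prod.fst_add, Prod.snd_add, inner_add_right]
      rw [h4 p hp, k4 p hp]
      ring
  smul_mem' := by
    rintro c a ⟨h1, h2, h3, h4⟩
    refine ⟨?_, ?_, ?_, ?_⟩
    · intro φ e1 e2 e3 P Q e4 e5
      simp only [Prod.smul_fst, Prod.smul_snd, real_inner_smul_left]
      rw [h1 φ e1 e2 e3 P Q e4 e5]
    · intro φ e1 e2 e3 P Q e4 e5
      simp only [Prod.smul_fst, Prod.smul_snd, real_inner_smul_left]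
      rw [h2 φ e1 e2 e3 P Q e4 e5]
    · exact (smoothTan K).topologicalClosure.smul_mem c h3
    · intro p hp
      simp only [Prod.smul_fst, Prod.smul_snd, real_inner_smul_right]
      rw [h4 p hp]
      ring

instance instNormedTraceSpace {n : ℕ} (K : Set (Euc n)) : NormedAddCommGroup (TraceSpace K) :=
  Submodule.normedAddCommGroup _

instance instNormedSpaceTraceSpace {n : ℕ} (K : Set (Euc n)) : NormedSpace ℝ (TraceSpace K) :=
  Submodule.normedSpace _

/-! ### `ℝ²`-valued objects

`V ⊗ ℝ²` is identified with `V × V`, its elements being written `(q, p)`. -/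

/-- The inner product on `H ⊗ ℝ²`. -/
def inner2 {H : Type*} [NormedAddCommGroup H] [InnerProductSpace ℝ H] (a b : H × H) : ℝ :=
  ⟪a.1, b.1⟫_ℝ + ⟪a.2, b.2⟫_ℝ

/-- `J (q, p) = (-p, q)`. -/
def symplJ {V : Type*} [AddCommGroup V] (a : V × V) : V × V := (-a.2, a.1)

/-- The inclusion `S ⊗ ℝ² ⊆ V ⊗ ℝ²` for a subspace `S ⊆ V`. -/
def incl {V : Type*} [AddCommGroup V] [Module ℝ V] {S : Submodule ℝ V} (a : S × S) : V × V :=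
  ((a.1 : V), (a.2 : V))

variable {n : ℕ} {K : Set (Euc n)} {W : Submodule ℝ (TraceSpace K)}

/-- The underlying `L²` form of `w ∈ W ⊗ ℝ²`. -/
def form (w : W × W) : L2Form K × L2Form K := (w.1.1.1.1.1, w.2.1.1.1.1)

/-- The Hodge-Dirac operator `D w = d w + δ w` on `W ⊗ ℝ²`. -/
def dirac (w : W × W) : L2Form K × L2Form K :=
  (w.1.1.1.1.2.1 + w.1.1.1.1.2.2, w.2.1.1.1.2.1 + w.2.1.1.1.2.2)

/-- The tangential trace of `w ∈ W ⊗ ℝ²`. -/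
def tanTr (w : W × W) : L2Bdry K × L2Bdry K := (w.1.1.1.2.1, w.2.1.1.2.1)

/-- The normal trace of `w ∈ W ⊗ ℝ²`. -/
def norTr (w : W × W) : L2Bdry K × L2Bdry K := (w.1.1.1.2.2, w.2.1.1.2.2)

/-- `[w₁, w₂]_{∂K} = ⟨w₁^tan, w₂^nor⟩_{∂K} - ⟨w₂^tan, w₁^nor⟩_{∂K}`, for pairs of traces
`wᵢ = (wᵢ^nor, wᵢ^tan)`. -/
def bracket (w₁ w₂ : (L2Bdry K × L2Bdry K) × (L2Bdry K × L2Bdry K)) : ℝ :=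
  inner2 w₁.2 w₂.1 - inner2 w₂.2 w₁.1

/-- The pair `(w^nor, w^tan)` of traces of `w ∈ W ⊗ ℝ²`. -/
def traces (w : W × W) : (L2Bdry K × L2Bdry K) × (L2Bdry K × L2Bdry K) := (norTr w, tanTr w)

/-! ### Hybrid finite element spaces -/

/-- The `K i` form a partition of the bounded Lipschitz domain `Ω` into non-overlapping Lipschitz
subdomains. -/
structure IsLipschitzPartition {n : ℕ} {ι : Type*} (Ω : Set (Euc n)) (K : ι → Set (Euc n)) :
    Prop where
  domain : IsLipschitzDomain Ω
  element : ∀ i, IsLipschitzDomain (K i)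
  subset : ∀ i, K i ⊆ Ω
  disjoint : ∀ i j, i ≠ j → Disjoint (K i) (K j)
  cover : closure Ω = ⋃ i, closure (K i)

/-- The local spaces `W_h(K)`, `Ŵ_h^nor(∂K)` and `Ŵ_h^tan(∂K)`. -/
structure Spaces {n : ℕ} {ι : Type*} (K : ι → Set (Euc n)) where
  W : ∀ i, Submodule ℝ (TraceSpace (K i))
  Wnor : ∀ i, Submodule ℝ (L2Bdry (K i))
  Wtan : ∀ i, Submodule ℝ (L2Bdry (K i))

section Discrete

variable {ι : Type*} {L : ι → Set (Euc n)} (S : Spaces L)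

instance instNormedW (i : ι) : NormedAddCommGroup (S.W i) := Submodule.normedAddCommGroup _

instance instNormedSpaceW (i : ι) : NormedSpace ℝ (S.W i) := Submodule.normedSpace _

instance instNormedWnor (i : ι) : NormedAddCommGroup (S.Wnor i) := Submodule.normedAddCommGroup _

instance instNormedSpaceWnor (i : ι) : NormedSpace ℝ (S.Wnor i) := Submodule.normedSpace _

instance instNormedWtan (i : ι) : NormedAddCommGroup (S.Wtan i) := Submodule.normedAddCommGroup _

instance instNormedSpaceWtan (i : ι) : NormedSpace ℝ (S.Wtan i) := Submodule.normedSpace _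

/-- `W_h ⊗ ℝ²`. -/
abbrev Wb : Type _ := ∀ i, S.W i × S.W i

/-- `Ŵ_h^nor ⊗ ℝ²`. -/
abbrev Nb : Type _ := ∀ i, S.Wnor i × S.Wnor i

/-- The value at `x` of the `i`-th component of `v ∈ Ŵ_h^tan`. -/
def tanVal (v : ∀ i, S.Wtan i) (i : ι) (x : Euc n) : AltR n :=
  ((v i : L2Bdry (L i)) : Lp (AltR n) 2 (surf (frontier (L i)))) x

theorem ae_tanVal_add (u v : ∀ i, S.Wtan i) (i : ι) {Γ : Set (Euc n)} (h : Γ ⊆ frontier (L i)) :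
    ∀ᵐ x ∂(surf Γ), tanVal S (u + v) i x = tanVal S u i x + tanVal S v i x :=
  ae_mono (Measure.restrict_mono h le_rfl)
    (Lp.coeFn_add ((u i : L2Bdry (L i)) : Lp (AltR n) 2 (surf (frontier (L i)))) (v i))

theorem ae_tanVal_smul (c : ℝ) (v : ∀ i, S.Wtan i) (i : ι) {Γ : Set (Euc n)}
    (h : Γ ⊆ frontier (L i)) : ∀ᵐ x ∂(surf Γ), tanVal S (c • v) i x = c • tanVal S v i x :=
  ae_mono (Measure.restrict_mono h le_rfl)
    (Lp.coeFn_smul c ((v i : L2Bdry (L i)) : Lp (AltR n) 2 (surf (frontier (L i)))))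

theorem ae_tanVal_zero (i : ι) {Γ : Set (Euc n)} (h : Γ ⊆ frontier (L i)) :
    ∀ᵐ x ∂(surf Γ), tanVal S 0 i x = 0 :=
  ae_mono (Measure.restrict_mono h le_rfl) (Lp.coeFn_zero (AltR n) 2 (surf (frontier (L i))))

/-- `V̂_h^tan`: the `v ∈ Ŵ_h^tan` that are single-valued on the interior skeleton. -/
def Vhat (Ω : Set (Euc n)) : Submodule ℝ (∀ i, S.Wtan i) where
  carrier := {v | ∀ i j, i ≠ j → ∀ᵐ x ∂(surf ((frontier (L i) ∩ frontier (L j)) \ frontier Ω)),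
    tanVal S v i x = tanVal S v j x}
  zero_mem' := by
    intro i j _
    filter_upwards [ae_tanVal_zero S i (sdiff_subset.trans inter_subset_left),
      ae_tanVal_zero S j (sdiff_subset.trans inter_subset_right)] with x h1 h2
    rw [h1, h2]
  add_mem' := by
    intro u v hu hv i j hij
    filter_upwards [ae_tanVal_add S u v i (sdiff_subset.trans inter_subset_left),
      ae_tanVal_add S u v j (sdiff_subset.trans inter_subset_right), hu i j hij, hv i j hij]
      with x h1 h2 h3 h4
    rw [h1, h2, h3, h4]
  smul_mem' := by
    intro c v hv i j hij
    filter_upwards [ae_tanVal_smul S c v i (sdiff_subset.trans inter_subset_left),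
      ae_tanVal_smul S c v j (sdiff_subset.trans inter_subset_right), hv i j hij]
      with x h1 h2 h3
    rw [h1, h2, h3]

/-- `V̊_h^tan`: the `v ∈ V̂_h^tan` that vanish on `∂Ω`. -/
def Vring (Ω : Set (Euc n)) : Submodule ℝ (∀ i, S.Wtan i) where
  carrier := {v | v ∈ Vhat S Ω ∧
    ∀ i, ∀ᵐ x ∂(surf (frontier (L i) ∩ frontier Ω)), tanVal S v i x = 0}
  zero_mem' := ⟨(Vhat S Ω).zero_mem, fun i => ae_tanVal_zero S i inter_subset_left⟩
  add_mem' := by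
    rintro u v ⟨hu, hu'⟩ ⟨hv, hv'⟩
    refine ⟨(Vhat S Ω).add_mem hu hv, fun i => ?_⟩
    filter_upwards [ae_tanVal_add S u v i inter_subset_left, hu' i, hv' i] with x h1 h2 h3
    rw [h1, h2, h3, add_zero]
  smul_mem' := by
    rintro c v ⟨hv, hv'⟩
    refine ⟨(Vhat S Ω).smul_mem c hv, fun i => ?_⟩
    filter_upwards [ae_tanVal_smul S c v i inter_subset_left, hv' i] with x h1 h2
    rw [h1, h2, smul_zero]

variable {S}

/-- The `i`-th component of an element of `V ⊗ ℝ²`, where `V` is a subspace of `Ŵ_h^tan`. -/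
def tanAt {V : Submodule ℝ (∀ i, S.Wtan i)} (v : V × V) (i : ι) : S.Wtan i × S.Wtan i :=
  (v.1.1 i, v.2.1 i)

/-- The pair `(ŵ^nor, ŵ^tan)` on `∂K i`. -/
def hatAt {V : Submodule ℝ (∀ i, S.Wtan i)} (wn : Nb S) (wt : V × V) (i : ι) :
    (L2Bdry (L i) × L2Bdry (L i)) × (L2Bdry (L i) × L2Bdry (L i)) :=
  (incl (wn i), incl (tanAt wt i))

variable (S)

/-- A local flux function `Φ = ∏ Φ_K`. -/
abbrev Flux : Type _ := ∀ i,
  ((S.W i × S.W i) × (S.Wnor i × S.Wnor i) × (S.Wtan i × S.Wtan i)) →L[ℝ]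
    (L2Bdry (L i) × L2Bdry (L i))

/-- A local source term `f = ∏ f_K`. -/
abbrev Source : Type _ := ∀ i, ℝ → (S.W i × S.W i) → (L2Form (L i) × L2Form (L i))

variable {S} [Fintype ι]

/-- `f(t, z_h)`. -/
def sourceMap (f : Source S) (t : ℝ) (z : Wb S) : ∀ i, L2Form (L i) × L2Form (L i) :=
  fun i => f i t (z i)

/-- The weak evolution equation at time `t` tested with `w`:
`(J ż, w) + (z, D w) + [ẑ, w] = (f(t, z), w)`, with `ẑ = (zn, zt)`. -/
def EvolutionEq {V : Submodule ℝ (∀ i, S.Wtan i)} (f : Source S) (t : ℝ)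
    (zdot z : Wb S) (zn : Nb S) (zt : V × V) (w : Wb S) : Prop :=
  ∑ i, inner2 (symplJ (form (zdot i))) (form (w i)) + ∑ i, inner2 (form (z i)) (dirac (w i)) +
      ∑ i, bracket (hatAt zn zt i) (traces (w i)) =
    ∑ i, inner2 (sourceMap f t z i) (form (w i))

/-- The flux equation `⟨Φ(z, ẑ), ŵ^nor⟩ = 0` for all `ŵ^nor ∈ Ŵ_h^nor ⊗ ℝ²`. -/
def FluxEq {V : Submodule ℝ (∀ i, S.Wtan i)} (Φ : Flux S) (z : Wb S) (zn : Nb S)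
    (zt : V × V) : Prop :=
  ∀ wn : Nb S, ∑ i, inner2 (Φ i (z i, zn i, tanAt zt i)) (incl (wn i)) = 0

/-- The conservation equation `⟨ẑ^nor, ŵ^tan⟩ = 0` for all `ŵ^tan ∈ V̊_h^tan ⊗ ℝ²`. -/
def ConservationEq (Ω : Set (Euc n)) (zn : Nb S) : Prop :=
  ∀ wt : Vring S Ω × Vring S Ω, ∑ i, inner2 (incl (zn i)) (incl (tanAt wt i)) = 0

/-- The flux `Φ` is multisymplectic: `[ŵ₁ - w₁, ŵ₂ - w₂]_{∂K} = 0` for every `K`, whenever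
`(w₁, ŵ₁)` and `(w₂, ŵ₂)` satisfy the flux equation. -/
def Multisymplectic (Ω : Set (Euc n)) (Φ : Flux S) : Prop :=
  ∀ (w₁ w₂ : Wb S) (n₁ n₂ : Nb S) (t₁ t₂ : Vhat S Ω × Vhat S Ω),
    FluxEq Φ w₁ n₁ t₁ → FluxEq Φ w₂ n₂ t₂ →
      ∀ i, bracket (hatAt n₁ t₁ i - traces (w₁ i)) (hatAt n₂ t₂ i - traces (w₂ i)) = 0

/-- `∂f/∂z_h` is symmetric. -/
def SymmetricSource (I : Set ℝ) (f : Source S) : Prop :=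
  ∀ t ∈ I, ∀ z w₁ w₂ : Wb S,
    ∑ i, inner2 (fderiv ℝ (sourceMap f t) z w₁ i) (form (w₂ i)) =
      ∑ i, inner2 (fderiv ℝ (sourceMap f t) z w₂ i) (form (w₁ i))

/-! ### Reduction to an ODE -/

variable {Wt : Type*} [NormedAddCommGroup Wt] [InnerProductSpace ℝ Wt]

variable (S Wt) in
/-- Maps `Θ(t, z̃) = (z_h, (ẑ_h^nor, ẑ_h^tan))`. -/
abbrev ThetaMap (Ω : Set (Euc n)) : Type _ :=
  ℝ → Wt × Wt → Wb S × Nb S × (Vring S Ω × Vring S Ω)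

/-- The derivative `∂z_h/∂z̃_h` of the first component of `Θ`. -/
def dz {Ω : Set (Euc n)} (Θ : ThetaMap S Wt Ω) (t : ℝ) (z : Wt × Wt) :
    (Wt × Wt) →L[ℝ] Wb S :=
  fderiv ℝ (fun y => (Θ t y).1) z

/-- The reduction assumption on `Θ`. -/
structure ReductionAssumption (Ω : Set (Euc n)) (I : Set ℝ) (f : Source S) (Φ : Flux S)
    (Θ : ThetaMap S Wt Ω) : Prop where
  /-- `Θ` is `C¹` and its first component is `C²` in `z̃`. -/
  smooth : ∀ t ∈ I, ContDiff ℝ 1 (Θ t)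
  smooth_fst : ∀ t ∈ I, ContDiff ℝ 2 (fun z => (Θ t z).1)
  /-- The map `z̃ ↦ z_h` is constant in `t` and symplectic. -/
  const : ∀ s ∈ I, ∀ t ∈ I, ∀ z, (Θ s z).1 = (Θ t z).1
  symplectic : ∀ t ∈ I, ∀ z w₁ w₂ : Wt × Wt,
    ∑ i, inner2 (symplJ (form (dz Θ t z w₁ i))) (form (dz Θ t z w₂ i)) = inner2 (symplJ w₁) w₂
  /-- It suffices to test the evolution equation with the variations `(∂z_h/∂z̃_h) w̃`. -/
  test : ∀ t ∈ I, ∀ z zdot : Wt × Wt,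
    (∀ w : Wt × Wt, EvolutionEq f t (dz Θ t z zdot) (Θ t z).1 (Θ t z).2.1 (Θ t z).2.2
      (dz Θ t z w)) →
    ∀ w : Wb S, EvolutionEq f t (dz Θ t z zdot) (Θ t z).1 (Θ t z).2.1 (Θ t z).2.2 w
  /-- The constraint equations hold on the image of `Θ`. -/
  flux : ∀ t ∈ I, ∀ z : Wt × Wt, FluxEq Φ (Θ t z).1 (Θ t z).2.1 (Θ t z).2.2
  conservation : ∀ t ∈ I, ∀ z : Wt × Wt, ConservationEq Ω (Θ t z).2.1

/-- `w ↦ (f(t, z), w) - (z, D w) - [ẑ, w]`, with `ẑ = (zn, zt)`. -/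
def residual {V : Submodule ℝ (∀ i, S.Wtan i)} (f : Source S) (t : ℝ) (z : Wb S) (zn : Nb S)
    (zt : V × V) : Wb S →L[ℝ] ℝ where
  toFun w := ∑ i, inner2 (sourceMap f t z i) (form (w i)) - ∑ i, inner2 (form (z i)) (dirac (w i)) -
    ∑ i, bracket (hatAt zn zt i) (traces (w i))
  map_add' u v := by
    simp only [← Finset.sum_sub_distrib, ← Finset.sum_add_distrib]
    refine Finset.sum_congr rfl fun i _ => ?_
    simp only [inner2, bracket, form, dirac, traces, tanTr, norTr, Pi.add_apply, Prod.fst_add,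
      Prod.snd_add, Submodule.coe_add, inner_add_left, inner_add_right]
    ring
  map_smul' c u := by
    simp only [← Finset.sum_sub_distrib, Finset.smul_sum, RingHom.id_apply]
    refine Finset.sum_congr rfl fun i _ => ?_
    simp only [inner2, bracket, form, dirac, traces, tanTr, norTr, Pi.smul_apply, Prod.smul_fst,
      Prod.smul_snd, Submodule.coe_smul, real_inner_smul_left, inner_add_right,
      real_inner_smul_right, smul_eq_mul]
    ring
  cont := by
    simp only [inner2, bracket, form, dirac, traces, tanTr, norTr]
    fun_prop

/-- The Riesz representative of a functional on `H ⊗ ℝ²`. -/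
def riesz2 {H : Type*} [NormedAddCommGroup H] [InnerProductSpace ℝ H] [CompleteSpace H]
    (ℓ : (H × H) →L[ℝ] ℝ) : H × H :=
  ((InnerProductSpace.toDual ℝ H).symm (ℓ.comp (ContinuousLinearMap.inl ℝ H H)),
    (InnerProductSpace.toDual ℝ H).symm (ℓ.comp (ContinuousLinearMap.inr ℝ H H)))

theorem inner2_riesz2 {H : Type*} [NormedAddCommGroup H] [InnerProductSpace ℝ H] [CompleteSpace H]
    (ℓ : (H × H) →L[ℝ] ℝ) (w : H × H) : inner2 (riesz2 ℓ) w = ℓ w := by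
  simp only [inner2, riesz2, InnerProductSpace.toDual_symm_apply, ContinuousLinearMap.comp_apply,
    ContinuousLinearMap.inl_apply, ContinuousLinearMap.inr_apply]
  rw [← map_add]
  simp

/-- The reduced vector field `f̃`, defined by
`(f̃(t, z̃), w̃) = (f(t, z), w) - (z, D w) - [ẑ, w]` for all `w̃`, where `(z, ẑ) = Θ(t, z̃)` and
`w = (∂z_h/∂z̃_h) w̃`. -/
def reducedField [CompleteSpace Wt] {Ω : Set (Euc n)} (f : Source S) (Θ : ThetaMap S Wt Ω)
    (t : ℝ) (z : Wt × Wt) : Wt × Wt :=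
  riesz2 ((residual f t (Θ t z).1 (Θ t z).2.1 (Θ t z).2.2).comp (dz Θ t z))

/-- The defining equation of `f̃`, written out. -/
theorem inner2_reducedField [CompleteSpace Wt] {Ω : Set (Euc n)} (f : Source S)
    (Θ : ThetaMap S Wt Ω) (t : ℝ) (z w : Wt × Wt) :
    inner2 (reducedField f Θ t z) w =
      ∑ i, inner2 (sourceMap f t (Θ t z).1 i) (form (dz Θ t z w i)) -
        ∑ i, inner2 (form ((Θ t z).1 i)) (dirac (dz Θ t z w i)) -
        ∑ i, bracket (hatAt (Θ t z).2.1 (Θ t z).2.2 i) (traces (dz Θ t z w i)) :=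
  inner2_riesz2 _ w

end Discrete

/-- `z` solves the ODE `J ż = F(t, z)` on the time interval `I`. -/
def IsSolution {V : Type*} [NormedAddCommGroup V] [NormedSpace ℝ V] (I : Set ℝ)
    (F : ℝ → V × V → V × V) (z : ℝ → V × V) : Prop :=
  ∀ t ∈ I, ∃ zdot : V × V, HasDerivWithinAt z zdot I t ∧ symplJ zdot = F t (z t)

/-- The ODE `J ż = F(t, z)` is symplectic: any two solutions `w₁`, `w₂` of its variational equation
`J ẇ = (∂F/∂z)(t, z(t)) w` at any solution `z`, on any subinterval of `I`, satisfy
`d/dt (J w₁, w₂) = 0`. -/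
def IsSymplecticODE {V : Type*} [NormedAddCommGroup V] [InnerProductSpace ℝ V] (I : Set ℝ)
    (F : ℝ → V × V → V × V) : Prop :=
  ∀ I' ⊆ I, I'.OrdConnected → ∀ z w₁ w₂ : ℝ → V × V, IsSolution I' F z →
    IsSolution I' (fun t w => fderiv ℝ (F t) (z t) w) w₁ →
    IsSolution I' (fun t w => fderiv ℝ (F t) (z t) w) w₂ →
    ∀ t ∈ I', HasDerivWithinAt (fun s => inner2 (symplJ (w₁ s)) (w₂ s)) 0 I' t

end HybridFEEC

end

/-! Write `x` for the map z̃ ↦ z_h and `R` for the residual functional, so that (f̃(z̃), w̃) =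
R(z̃)(x'(z̃) w̃). Differentiating in a second direction produces two terms. The first, R(x''(w̃₁,
w̃₂)), is symmetric by Schwarz's theorem. The second is (∂f w₁, w₂) - (w₁, D w₂) - [ŵ₁, w₂], where
(wᵢ, ŵᵢ) is the variation of Θ in the direction w̃ᵢ. Since ∂f is symmetric, it remains to see that
(w₁, D w₂) + [ŵ₁, w₂] is symmetric in the two variations.

This is the multisymplectic conservation law, `Multisymplectic.sum_symm`. The flux and conservation
equations are linear in (z, ẑ) and hold along Θ, so every variation satisfies them too. Expanding
[ŵ₁ - w₁, ŵ₂ - w₂] = 0 on each K and inserting Green's formula [w₁, w₂] = (D w₁, w₂) - (w₁, D w₂)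
(`bracket_traces`) identifies the local defect of symmetry with [ŵ₁, ŵ₂]. Its sum over all K
vanishes, because the tangential trace of each variation is an admissible test function in the
conservation equation of the other.

Symplecticity of the ODE then follows from skewness of J (`isSymplecticODE_of_symmetric`): the
derivative of (J w₁, w₂) is (∂F w₁, w₂) - (w₁, ∂F w₂). The differential calculus is carried out for
abstract bounded bilinear forms in `contDiff_and_symmetric_of_eq_bilinear`, and the semidiscrete
equations enter only through the pairings substituted there. -/

noncomputable section

namespace HybridFEEC

/-! ### Pairings on `H ⊗ ℝ²` -/

section Pairing

variable {H : Type*} [NormedAddCommGroup H] [InnerProductSpace ℝ H]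

/-- `inner2` as a bounded bilinear map. -/
def inner2L : (H × H) →L[ℝ] (H × H) →L[ℝ] ℝ :=
  (innerSL ℝ).bilinearComp (ContinuousLinearMap.fst ℝ H H) (ContinuousLinearMap.fst ℝ H H) +
    (innerSL ℝ).bilinearComp (ContinuousLinearMap.snd ℝ H H) (ContinuousLinearMap.snd ℝ H H)

@[simp]
theorem inner2L_apply (a b : H × H) : inner2L a b = inner2 a b := rfl

theorem inner2_comm (a b : H × H) : inner2 a b = inner2 b a := by
  simp only [inner2, real_inner_comm]

theorem inner2_symplJ_left (a b : H × H) : inner2 (symplJ a) b = -inner2 a (symplJ b) := by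
  simp only [inner2, symplJ, inner_neg_left, inner_neg_right]
  ring

theorem inner2_sub_left (a b c : H × H) : inner2 (a - b) c = inner2 a c - inner2 b c := by
  simp only [inner2, Prod.fst_sub, Prod.snd_sub, inner_sub_left]
  ring

theorem inner2_sub_right (a b c : H × H) : inner2 a (b - c) = inner2 a b - inner2 a c := by
  simp only [inner2, Prod.fst_sub, Prod.snd_sub, inner_sub_right]
  ring

/-- `riesz2` as a bounded linear map. -/
def riesz2L [CompleteSpace H] : ((H × H) →L[ℝ] ℝ) →L[ℝ] H × H :=
  ContinuousLinearMap.prod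
    ((InnerProductSpace.toDual ℝ H).symm.toContinuousLinearEquiv.toContinuousLinearMap.comp
      ((ContinuousLinearMap.compL ℝ H (H × H) ℝ).flip (ContinuousLinearMap.inl ℝ H H)))
    ((InnerProductSpace.toDual ℝ H).symm.toContinuousLinearEquiv.toContinuousLinearMap.comp
      ((ContinuousLinearMap.compL ℝ H (H × H) ℝ).flip (ContinuousLinearMap.inr ℝ H H)))

/-- An ODE `J ż = F(t, z)` is symplectic when the derivatives `∂F/∂z` are symmetric. -/
theorem isSymplecticODE_of_symmetric {I : Set ℝ} {F : ℝ → H × H → H × H}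
    (hF : ∀ t ∈ I, ∀ z w₁ w₂ : H × H,
      inner2 (fderiv ℝ (F t) z w₁) w₂ = inner2 w₁ (fderiv ℝ (F t) z w₂)) :
    IsSymplecticODE I F := by
  intro I' hI' _ z w₁ w₂ _ h₁ h₂ t ht
  obtain ⟨v₁, hv₁, e₁⟩ := h₁ t ht
  obtain ⟨v₂, hv₂, e₂⟩ := h₂ t ht
  -- By the variational equation J vᵢ = ∂F wᵢ, and J is skew, so the sum equals (∂F w₁, w₂) - (w₁,
  -- ∂F w₂).
  have key : inner2 (symplJ v₁) (w₂ t) + inner2 (symplJ (w₁ t)) v₂ = 0 := by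
    rw [inner2_symplJ_left (w₁ t), e₁, e₂, hF t (hI' ht)]
    ring
  have a₁ : HasDerivWithinAt (fun s => (w₁ s).1) v₁.1 I' t :=
    (ContinuousLinearMap.fst ℝ H H).hasFDerivAt.comp_hasDerivWithinAt t hv₁
  have a₂ : HasDerivWithinAt (fun s => (w₁ s).2) v₁.2 I' t :=
    (ContinuousLinearMap.snd ℝ H H).hasFDerivAt.comp_hasDerivWithinAt t hv₁
  have b₁ : HasDerivWithinAt (fun s => (w₂ s).1) v₂.1 I' t :=
    (ContinuousLinearMap.fst ℝ H H).hasFDerivAt.comp_hasDerivWithinAt t hv₂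
  have b₂ : HasDerivWithinAt (fun s => (w₂ s).2) v₂.2 I' t :=
    (ContinuousLinearMap.snd ℝ H H).hasFDerivAt.comp_hasDerivWithinAt t hv₂
  -- In components, (J w₁, w₂) = -(p₁, q₂) + (q₁, p₂) for wᵢ = (qᵢ, pᵢ), to which the product rule
  -- applies.
  have h := (a₂.neg.inner ℝ b₁).add (a₁.inner ℝ b₂)
  rw [← key]
  refine h.congr_deriv ?_
  simp only [inner2, symplJ, Pi.neg_apply]
  ring

/-- The bounded bilinear form `(x, y) ↦ ∑ i, (p i x, q i y)`. -/
def sumPairing {ι : Type*} [Fintype ι] {H : ι → Type*} [∀ i, NormedAddCommGroup (H i)]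
    [∀ i, InnerProductSpace ℝ (H i)] {X Y : Type*} [NormedAddCommGroup X] [NormedSpace ℝ X]
    [NormedAddCommGroup Y] [NormedSpace ℝ Y] (p : ∀ i, X →L[ℝ] H i × H i)
    (q : ∀ i, Y →L[ℝ] H i × H i) : X →L[ℝ] Y →L[ℝ] ℝ :=
  ∑ i, inner2L.bilinearComp (p i) (q i)

theorem sumPairing_apply {ι : Type*} [Fintype ι] {H : ι → Type*} [∀ i, NormedAddCommGroup (H i)]
    [∀ i, InnerProductSpace ℝ (H i)] {X Y : Type*} [NormedAddCommGroup X] [NormedSpace ℝ X]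
    [NormedAddCommGroup Y] [NormedSpace ℝ Y] (p : ∀ i, X →L[ℝ] H i × H i)
    (q : ∀ i, Y →L[ℝ] H i × H i) (x : X) (y : Y) :
    sumPairing p q x y = ∑ i, inner2 (p i x) (q i y) := by
  simp [sumPairing]

end Pairing

/-! ### Pairings on products -/

section Family

variable {ι : Type*} [Fintype ι] {H X Y N T : ι → Type*}
  [∀ i, NormedAddCommGroup (H i)] [∀ i, InnerProductSpace ℝ (H i)]
  [∀ i, NormedAddCommGroup (X i)] [∀ i, NormedSpace ℝ (X i)]
  [∀ i, NormedAddCommGroup (Y i)] [∀ i, NormedSpace ℝ (Y i)]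
  [∀ i, NormedAddCommGroup (N i)] [∀ i, NormedSpace ℝ (N i)]
  [∀ i, NormedAddCommGroup (T i)] [∀ i, NormedSpace ℝ (T i)]

/-- The bounded bilinear form `(x, y) ↦ ∑ i, (p i (x i), q i (y i))`. -/
def piPairing (p : ∀ i, X i →L[ℝ] H i × H i) (q : ∀ i, Y i →L[ℝ] H i × H i) :
    (∀ i, X i) →L[ℝ] (∀ i, Y i) →L[ℝ] ℝ :=
  sumPairing (fun i => (p i).comp (ContinuousLinearMap.proj i))
    (fun i => (q i).comp (ContinuousLinearMap.proj i))

theorem piPairing_apply (p : ∀ i, X i →L[ℝ] H i × H i) (q : ∀ i, Y i →L[ℝ] H i × H i)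
    (x : ∀ i, X i) (y : ∀ i, Y i) : piPairing p q x y = ∑ i, inner2 (p i (x i)) (q i (y i)) :=
  sumPairing_apply _ _ x y

/-- The `i`-th component of an element of `V ⊗ ℝ²`, where `V` is a subspace of a product, as a bounded
linear map. -/
def evalL (V : Submodule ℝ (∀ i, T i)) (i : ι) : (V × V) →L[ℝ] T i × T i :=
  ((ContinuousLinearMap.proj i).comp V.subtypeL).prodMap
    ((ContinuousLinearMap.proj i).comp V.subtypeL)

/-- The bounded bilinear form `(v, y) ↦ ∑ i, (p i (v i), q i (y i))` for `v ∈ V ⊗ ℝ²`, where `V` is a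
subspace of a product. -/
def subPairing (V : Submodule ℝ (∀ i, T i)) (p : ∀ i, (T i × T i) →L[ℝ] H i × H i)
    (q : ∀ i, Y i →L[ℝ] H i × H i) : (V × V) →L[ℝ] (∀ i, Y i) →L[ℝ] ℝ :=
  sumPairing (fun i => (p i).comp (evalL V i)) (fun i => (q i).comp (ContinuousLinearMap.proj i))

theorem subPairing_apply (V : Submodule ℝ (∀ i, T i)) (p : ∀ i, (T i × T i) →L[ℝ] H i × H i)
    (q : ∀ i, Y i →L[ℝ] H i × H i) (v : V × V) (y : ∀ i, Y i) :
    subPairing V p q v y = ∑ i, inner2 (p i (v.1.1 i, v.2.1 i)) (q i (y i)) :=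
  sumPairing_apply _ _ v y

/-- The bounded linear form `(x, y, v) ↦ ∑ i, (Φ i (x i, y i, v i), h i)`. -/
def fluxForm (V : Submodule ℝ (∀ i, T i)) (Φ : ∀ i, (X i × N i × (T i × T i)) →L[ℝ] H i × H i)
    (h : ∀ i, H i × H i) : ((∀ i, X i) × (∀ i, N i) × (V × V)) →L[ℝ] ℝ :=
  ∑ i, (inner2L.flip (h i)).comp ((Φ i).comp
    ((ContinuousLinearMap.proj i).prodMap ((ContinuousLinearMap.proj i).prodMap (evalL V i))))

theorem fluxForm_apply (V : Submodule ℝ (∀ i, T i))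
    (Φ : ∀ i, (X i × N i × (T i × T i)) →L[ℝ] H i × H i) (h : ∀ i, H i × H i)
    (p : (∀ i, X i) × (∀ i, N i) × (V × V)) :
    fluxForm V Φ h p =
      ∑ i, inner2 (Φ i (p.1 i, p.2.1 i, (p.2.2.1.1 i, p.2.2.2.1 i))) (h i) := by
  simp only [fluxForm, sum_apply]
  rfl

end Family

/-! ### Reduction of a weak equation along a parametrization -/

section Calculus

variable {H E X Y Z : Type*} [NormedAddCommGroup H] [InnerProductSpace ℝ H]
  [NormedAddCommGroup E] [NormedSpace ℝ E] [NormedAddCommGroup X] [NormedSpace ℝ X]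
  [NormedAddCommGroup Y] [NormedSpace ℝ Y] [NormedAddCommGroup Z] [NormedSpace ℝ Z]
  {b : Z →L[ℝ] X →L[ℝ] ℝ} {a : X →L[ℝ] X →L[ℝ] ℝ} {c : Y →L[ℝ] X →L[ℝ] ℝ}
  {s : X → Z} {x : E → X} {y : E → Y} {R : E → X →L[ℝ] ℝ}

/-- In the application `x` and `y` are the components z_h and ẑ_h of Θ(t, ·), `s` is the source, and
`b`, `a`, `c` are the source, Dirac and bracket pairings. Currying the bounded bilinear forms turns
the pointwise formula into an identity of maps into the dual, so `R` is a combination of bounded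
linear maps composed with C¹ maps. -/
theorem contDiff_of_eq_bilinear (hR : ∀ z v, R z v = b (s (x z)) v - a (x z) v - c (y z) v)
    (hs : ContDiff ℝ 1 s) (hx : ContDiff ℝ 1 x) (hy : ContDiff ℝ 1 y) : ContDiff ℝ 1 R := by
  have h : R = fun z => b (s (x z)) - a (x z) - c (y z) := by
    funext z
    ext v
    simpa using hR z v
  rw [h]
  exact ((b.contDiff.comp (hs.comp hx)).sub (a.contDiff.comp hx)).sub (c.contDiff.comp hy)

theorem fderiv_eq_of_eq_bilinear (hR : ∀ z v, R z v = b (s (x z)) v - a (x z) v - c (y z) v)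
    (hs : ContDiff ℝ 1 s) (hx : ContDiff ℝ 1 x) (hy : ContDiff ℝ 1 y) (z w : E) (v : X) :
    fderiv ℝ R z w v = b (fderiv ℝ s (x z) (fderiv ℝ x z w)) v - a (fderiv ℝ x z w) v -
      c (fderiv ℝ y z w) v := by
  have h : R = fun z => b (s (x z)) - a (x z) - c (y z) := by
    funext z
    ext v
    simpa using hR z v
  have hx' := (hx.differentiable one_ne_zero z).hasFDerivAt
  have hs' := ((hs.differentiable one_ne_zero (x z)).hasFDerivAt.comp z hx')
  have hy' := (hy.differentiable one_ne_zero z).hasFDerivAt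
  have hd := ((b.hasFDerivAt.comp z hs').sub (a.hasFDerivAt.comp z hx')).sub
    (c.hasFDerivAt.comp z hy')
  have hd' : HasFDerivAt R _ z := hd.congr_of_eventuallyEq (.of_forall fun y => congrFun h y)
  rw [hd'.fderiv]
  rfl

/-- The test functions themselves depend on the point through `x'`, which costs one derivative: this
is why z_h has to be C² in z̃_h while C¹ suffices for ẑ_h. -/
theorem contDiff_riesz2_comp_fderiv [CompleteSpace H] {x : H × H → X} {R : H × H → X →L[ℝ] ℝ}
    (hR : ContDiff ℝ 1 R) (hx : ContDiff ℝ 2 x) :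
    ContDiff ℝ 1 fun z => riesz2 ((R z).comp (fderiv ℝ x z)) := by
  have h := hR.clm_comp (hx.fderiv_right (m := 1) (by norm_num [one_add_one_eq_two]))
  exact (ContinuousLinearMap.contDiff (riesz2L (H := H))).comp h

/-- The derivative of `z ↦ R(z) ∘ x'(z)` is symmetric if that of `R` is so on the range of `x'`. -/
theorem fderiv_riesz2_comp_fderiv_symmetric [CompleteSpace H] {x : H × H → X}
    {R : H × H → X →L[ℝ] ℝ} (hR : ContDiff ℝ 1 R) (hx : ContDiff ℝ 2 x) {z w₁ w₂ : H × H}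
    (h : fderiv ℝ R z w₁ (fderiv ℝ x z w₂) = fderiv ℝ R z w₂ (fderiv ℝ x z w₁)) :
    inner2 (fderiv ℝ (fun z => riesz2 ((R z).comp (fderiv ℝ x z))) z w₁) w₂ =
      inner2 w₁ (fderiv ℝ (fun z => riesz2 ((R z).comp (fderiv ℝ x z))) z w₂) := by
  have hx' : ContDiff ℝ 1 (fderiv ℝ x) :=
    hx.fderiv_right (m := 1) (by norm_num [one_add_one_eq_two])
  -- The derivative of y ↦ R(y)(x'(y) v), for fixed `v`, is computed in two ways: through the
  -- pairing of the represented field with `v`, and by the product rule. Uniqueness of the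
  -- derivative equates them.
  have expand : ∀ u v : H × H,
      inner2 (fderiv ℝ (fun z => riesz2 ((R z).comp (fderiv ℝ x z))) z u) v =
        R z (fderiv ℝ (fderiv ℝ x) z u v) + fderiv ℝ R z u (fderiv ℝ x z v) := by
    intro u v
    have hF := ((contDiff_riesz2_comp_fderiv hR hx).differentiable one_ne_zero z).hasFDerivAt
    have h₁ : HasFDerivAt (fun y => R y (fderiv ℝ x y v)) _ z :=
      (((inner2L (H := H)).flip v).hasFDerivAt.comp z hF).congr_of_eventuallyEq
        (.of_forall fun y => (inner2_riesz2 ((R y).comp (fderiv ℝ x y)) v).symm)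
    have h₂ := (hR.differentiable one_ne_zero z).hasFDerivAt.clm_apply
      ((hx'.differentiable one_ne_zero z).hasFDerivAt.clm_apply (hasFDerivAt_const v z))
    have := congrArg (fun ℓ => ℓ u) (h₁.unique h₂)
    simpa using this
  have hsnd : fderiv ℝ (fderiv ℝ x) z w₁ w₂ = fderiv ℝ (fderiv ℝ x) z w₂ w₁ :=
    (hx.contDiffAt.isSymmSndFDerivAt (by simp)) w₁ w₂
  rw [inner2_comm w₁, expand, expand, hsnd, h]

/-- Linear constraints are inherited by variations. -/
theorem clm_fderiv_eq_zero (ℓ : X →L[ℝ] ℝ) {x : E → X} (hx : ContDiff ℝ 1 x)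
    (h : ∀ z, ℓ (x z) = 0) (z w : E) : ℓ (fderiv ℝ x z w) = 0 := by
  have h₁ : HasFDerivAt (fun _ => (0 : ℝ)) _ z :=
    (ℓ.hasFDerivAt.comp z (hx.differentiable one_ne_zero z).hasFDerivAt).congr_of_eventuallyEq
      (.of_forall fun y => (h y).symm)
  exact congrArg (fun ℓ => ℓ w) (h₁.unique (hasFDerivAt_const 0 z))

/-- The form needed for the conservation equation, which constrains only the component ẑ^nor of Θ.
-/
theorem clm_fderiv_snd_fst_eq_zero (ℓ : Y →L[ℝ] ℝ) {x : E → X × Y × Z} (hx : ContDiff ℝ 1 x)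
    (h : ∀ z, ℓ (x z).2.1 = 0) (z w : E) : ℓ (fderiv ℝ x z w).2.1 = 0 :=
  clm_fderiv_eq_zero (ℓ.comp ((ContinuousLinearMap.fst ℝ Y Z).comp (ContinuousLinearMap.snd ℝ X _)))
    hx h z w

/-- A vector field defined by a weak residual along a parametrization `θ` is `C¹`, with symmetric
derivative, if the residual is symmetric on the variations of `θ`. -/
theorem contDiff_and_symmetric_of_eq_bilinear [CompleteSpace H] {θ : H × H → X × Y}
    {R : H × H → X →L[ℝ] ℝ}
    (hR : ∀ z v, R z v = b (s (θ z).1) v - a (θ z).1 v - c (θ z).2 v)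
    (hs : ContDiff ℝ 1 s) (hθ : ContDiff ℝ 1 θ) (hx : ContDiff ℝ 2 fun z => (θ z).1)
    (hsymm : ∀ z u v, b (fderiv ℝ s z u) v = b (fderiv ℝ s z v) u)
    (hac : ∀ z w₁ w₂, a (fderiv ℝ θ z w₁).1 (fderiv ℝ θ z w₂).1 +
      c (fderiv ℝ θ z w₁).2 (fderiv ℝ θ z w₂).1 = a (fderiv ℝ θ z w₂).1 (fderiv ℝ θ z w₁).1 +
      c (fderiv ℝ θ z w₂).2 (fderiv ℝ θ z w₁).1) :
    ContDiff ℝ 1 (fun z => riesz2 ((R z).comp (fderiv ℝ (fun y => (θ y).1) z))) ∧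
      ∀ z w₁ w₂,
        inner2 (fderiv ℝ (fun z => riesz2 ((R z).comp (fderiv ℝ (fun y => (θ y).1) z))) z w₁) w₂ =
          inner2 w₁
            (fderiv ℝ (fun z => riesz2 ((R z).comp (fderiv ℝ (fun y => (θ y).1) z))) z w₂) := by
  have hx₁ : ContDiff ℝ 1 fun z => (θ z).1 := hθ.fst
  have hy₁ : ContDiff ℝ 1 fun z => (θ z).2 := hθ.snd
  have hR₁ : ContDiff ℝ 1 R := contDiff_of_eq_bilinear hR hs hx₁ hy₁
  refine ⟨contDiff_riesz2_comp_fderiv hR₁ hx, fun z w₁ w₂ =>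
    fderiv_riesz2_comp_fderiv_symmetric hR₁ hx ?_⟩
  -- The variations of both components are read off from the single derivative of `θ`, since `hac`
  -- is stated for that derivative.
  have hd := (hθ.differentiable one_ne_zero z).hasFDerivAt
  have e₁ : ∀ w, fderiv ℝ (fun z => (θ z).1) z w = (fderiv ℝ θ z w).1 := fun w => by
    rw [hd.fst.fderiv]
    rfl
  have e₂ : ∀ w, fderiv ℝ (fun z => (θ z).2) z w = (fderiv ℝ θ z w).2 := fun w => by
    rw [hd.snd.fderiv]
    rfl
  rw [fderiv_eq_of_eq_bilinear hR hs hx₁ hy₁, fderiv_eq_of_eq_bilinear hR hs hx₁ hy₁]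
  simp only [e₁, e₂]
  rw [hsymm]
  linarith [hac z w₁ w₂]

end Calculus

/-! ### Green's formula -/

section Green

variable {n : ℕ} {K : Set (Euc n)}

/-- Both sides are continuous in `p`, so the identity cuts out a closed set. The weak normal trace
is defined by testing with smooth forms only; this carries Green's formula over to weak tangential
traces, which are limits of smooth ones in the graph norm. -/
theorem inner_eq_of_mem_topologicalClosure {A B : Type*} [NormedAddCommGroup A]
    [InnerProductSpace ℝ A] [NormedAddCommGroup B] [InnerProductSpace ℝ B]
    {P : Submodule ℝ (A × A × B)} {p : A × A × B} {v s : A} {η : B}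
    (hp : p ∈ P.topologicalClosure) (h : ∀ p ∈ P, ⟪p.2.2, η⟫_ℝ = ⟪p.2.1, v⟫_ℝ - ⟪p.1, s⟫_ℝ) :
    ⟪p.2.2, η⟫_ℝ = ⟪p.2.1, v⟫_ℝ - ⟪p.1, s⟫_ℝ := by
  have hcl : IsClosed {p : A × A × B | ⟪p.2.2, η⟫_ℝ = ⟪p.2.1, v⟫_ℝ - ⟪p.1, s⟫_ℝ} :=
    isClosed_eq (by fun_prop) (by fun_prop)
  exact closure_minimal h hcl hp

theorem IsNorTrace.inner_tanTrace {w u v s : L2Form K} {τ η : L2Bdry K}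
    (hτ : IsTanTrace K w u τ) (hη : IsNorTrace K v s η) :
    ⟪τ, η⟫_ℝ = ⟪u, v⟫_ℝ - ⟪w, s⟫_ℝ :=
  inner_eq_of_mem_topologicalClosure hτ hη

theorem isTanTrace_traceSpace (w : TraceSpace K) :
    IsTanTrace K w.1.1.1 w.1.1.2.1 w.1.2.1 := by
  obtain ⟨p, h⟩ := w
  exact h.2.2.1

theorem isNorTrace_traceSpace (w : TraceSpace K) :
    IsNorTrace K w.1.1.1 w.1.1.2.2 w.1.2.2 := by
  obtain ⟨p, h⟩ := w
  exact h.2.2.2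

theorem inner_traces_traceSpace (v w : TraceSpace K) :
    ⟪v.1.2.1, w.1.2.2⟫_ℝ = ⟪v.1.1.2.1, w.1.1.1⟫_ℝ - ⟪v.1.1.1, w.1.1.2.2⟫_ℝ :=
  (isNorTrace_traceSpace w).inner_tanTrace (isTanTrace_traceSpace v)

theorem inner2_sub_inner2_eq_of_green {A B : Type*} [NormedAddCommGroup A]
    [InnerProductSpace ℝ A] [NormedAddCommGroup B] [InnerProductSpace ℝ B]
    {w₁ u₁ s₁ w₂ u₂ s₂ : A × A} {τ₁ η₁ τ₂ η₂ : B × B}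
    (h₁ : ⟪τ₁.1, η₂.1⟫_ℝ = ⟪u₁.1, w₂.1⟫_ℝ - ⟪w₁.1, s₂.1⟫_ℝ)
    (h₂ : ⟪τ₁.2, η₂.2⟫_ℝ = ⟪u₁.2, w₂.2⟫_ℝ - ⟪w₁.2, s₂.2⟫_ℝ)
    (h₃ : ⟪τ₂.1, η₁.1⟫_ℝ = ⟪u₂.1, w₁.1⟫_ℝ - ⟪w₂.1, s₁.1⟫_ℝ)
    (h₄ : ⟪τ₂.2, η₁.2⟫_ℝ = ⟪u₂.2, w₁.2⟫_ℝ - ⟪w₂.2, s₁.2⟫_ℝ) :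
    inner2 τ₁ η₂ - inner2 τ₂ η₁ =
      inner2 w₂ (u₁.1 + s₁.1, u₁.2 + s₁.2) - inner2 w₁ (u₂.1 + s₂.1, u₂.2 + s₂.2) := by
  simp only [inner2, inner_add_right, h₁, h₂, h₃, h₄, real_inner_comm w₂.1 u₁.1,
    real_inner_comm w₂.2 u₁.2, real_inner_comm w₁.1 u₂.1, real_inner_comm w₁.2 u₂.2]
  ring

/-- Green's formula ⟨v^tan, w^nor⟩ = (dv, w) - (v, δw) is used in each component of ℝ² and with the
two arguments exchanged. In the difference, the terms with d and δ recombine into D. -/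
theorem bracket_traces {W : Submodule ℝ (TraceSpace K)} (w₁ w₂ : W × W) :
    bracket (traces w₁) (traces w₂) = inner2 (form w₂) (dirac w₁) - inner2 (form w₁) (dirac w₂) :=
  inner2_sub_inner2_eq_of_green (w₁ := form w₁) (w₂ := form w₂)
    (u₁ := (w₁.1.1.1.1.2.1, w₁.2.1.1.1.2.1)) (s₁ := (w₁.1.1.1.1.2.2, w₁.2.1.1.1.2.2))
    (u₂ := (w₂.1.1.1.1.2.1, w₂.2.1.1.1.2.1)) (s₂ := (w₂.1.1.1.1.2.2, w₂.2.1.1.1.2.2))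
    (inner_traces_traceSpace w₁.1.1 w₂.1.1) (inner_traces_traceSpace w₁.2.1 w₂.2.1)
    (inner_traces_traceSpace w₂.1.1 w₁.1.1) (inner_traces_traceSpace w₂.2.1 w₁.2.1)

/-- Bilinearity, with the term -[b, c] rewritten as [c, b] by antisymmetry, so that numerical traces
stand first in both mixed terms, as they do in the residual. -/
theorem bracket_sub_sub (a b c d : (L2Bdry K × L2Bdry K) × (L2Bdry K × L2Bdry K)) :
    bracket (a - b) (c - d) = bracket a c - bracket a d + bracket c b + bracket b d := by
  simp only [bracket, Prod.fst_sub, Prod.snd_sub, inner2_sub_left, inner2_sub_right]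
  ring

end Green

/-! ### Bounded linear maps underlying the semidiscrete equations -/

section Maps

variable {n : ℕ} {K : Set (Euc n)} (W : Submodule ℝ (TraceSpace K))

/-- `form` as a bounded linear map. -/
def formL : (W × W) →L[ℝ] L2Form K × L2Form K where
  toFun := form
  map_add' _ _ := rfl
  map_smul' _ _ := rfl
  cont := by unfold form; fun_prop

/-- `dirac` as a bounded linear map. -/
def diracL : (W × W) →L[ℝ] L2Form K × L2Form K where
  toFun := dirac
  map_add' a b := by
    simp only [dirac, Prod.fst_add, Prod.snd_add, Submodule.coe_add, Prod.mk_add_mk]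
    congr 1 <;> abel
  map_smul' c a := by
    simp only [dirac, Prod.smul_fst, Prod.smul_snd, Submodule.coe_smul, Prod.smul_mk, smul_add,
      RingHom.id_apply]
  cont := by unfold dirac; fun_prop

/-- `tanTr` as a bounded linear map. -/
def tanTrL : (W × W) →L[ℝ] L2Bdry K × L2Bdry K where
  toFun := tanTr
  map_add' _ _ := rfl
  map_smul' _ _ := rfl
  cont := by unfold tanTr; fun_prop

/-- `norTr` as a bounded linear map. -/
def norTrL : (W × W) →L[ℝ] L2Bdry K × L2Bdry K where
  toFun := norTr
  map_add' _ _ := rfl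
  map_smul' _ _ := rfl
  cont := by unfold norTr; fun_prop

/-- `incl` as a bounded linear map. -/
def inclL {X : Type*} [NormedAddCommGroup X] [NormedSpace ℝ X] (Y : Submodule ℝ X) :
    (Y × Y) →L[ℝ] X × X where
  toFun := incl
  map_add' _ _ := rfl
  map_smul' _ _ := rfl
  cont := by unfold incl; fun_prop

theorem comp_snd_sub_comp_fst_apply {P Q X : Type*} [NormedAddCommGroup P] [NormedSpace ℝ P]
    [NormedAddCommGroup Q] [NormedSpace ℝ Q] [NormedAddCommGroup X] [NormedSpace ℝ X]
    (A : Q →L[ℝ] X →L[ℝ] ℝ) (B : P →L[ℝ] X →L[ℝ] ℝ) (p : P × Q) (x : X) :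
    (A.comp (ContinuousLinearMap.snd ℝ P Q) - B.comp (ContinuousLinearMap.fst ℝ P Q)) p x =
      A p.2 x - B p.1 x :=
  rfl

end Maps

/-! ### The semidiscrete equations in terms of bounded linear maps

Each map is bundled with the formula for its values. -/

section Semidiscrete

variable {n : ℕ} {ι : Type*} [Fintype ι] {L : ι → Set (Euc n)} (S : Spaces L)
  (V : Submodule ℝ (∀ i, S.Wtan i))

/-- `(g, w) ↦ (g, w)`. -/
def sourcePairing : {b : (∀ i, L2Form (L i) × L2Form (L i)) →L[ℝ] Wb S →L[ℝ] ℝ //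
    ∀ g w, b g w = ∑ i, inner2 (g i) (form (w i))} :=
  ⟨piPairing (fun _ => ContinuousLinearMap.id ℝ _) (fun i => formL (S.W i)), piPairing_apply _ _⟩

/-- `(z, w) ↦ (z, D w)`. -/
def diracPairing : {a : Wb S →L[ℝ] Wb S →L[ℝ] ℝ //
    ∀ z w, a z w = ∑ i, inner2 (form (z i)) (dirac (w i))} :=
  ⟨piPairing (fun i => formL (S.W i)) (fun i => diracL (S.W i)), piPairing_apply _ _⟩

/-- `(ŵ^tan, w) ↦ ⟨ŵ^tan, w^nor⟩`. -/
def tanPairing : {c : (V × V) →L[ℝ] Wb S →L[ℝ] ℝ //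
    ∀ v w, c v w = ∑ i, inner2 (incl (tanAt v i)) (norTr (w i))} :=
  ⟨subPairing V (fun i => inclL (S.Wtan i)) (fun i => norTrL (S.W i)), subPairing_apply _ _ _⟩

/-- `(ŵ^nor, w) ↦ ⟨w^tan, ŵ^nor⟩`. -/
def norPairing : {c : Nb S →L[ℝ] Wb S →L[ℝ] ℝ //
    ∀ v w, c v w = ∑ i, inner2 (tanTr (w i)) (incl (v i))} :=
  ⟨(piPairing (fun i => tanTrL (S.W i)) (fun i => inclL (S.Wnor i))).flip,
    fun v w => piPairing_apply _ _ w v⟩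

/-- `(ŵ, w) ↦ [ŵ, w]`. -/
def bracketPairing : {c : (Nb S × (V × V)) →L[ℝ] Wb S →L[ℝ] ℝ //
    ∀ p w, c p w = ∑ i, bracket (hatAt p.1 p.2 i) (traces (w i))} :=
  ⟨(tanPairing S V).1.comp (ContinuousLinearMap.snd ℝ _ _) -
    (norPairing S).1.comp (ContinuousLinearMap.fst ℝ _ _), fun p w => by
      refine (comp_snd_sub_comp_fst_apply (tanPairing S V).1 (norPairing S).1 p w).trans ?_
      refine Eq.trans ?_ (Finset.sum_sub_distrib _ _).symm
      exact congrArg₂ (fun a b : ℝ => a - b) ((tanPairing S V).2 p.2 w) ((norPairing S).2 p.1 w)⟩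

variable {S}

/-- The left-hand side of the flux equation, as a function of `(z, ẑ)`. -/
def fluxL (Φ : Flux S) (wn : Nb S) : {ℓ : (Wb S × Nb S × (V × V)) →L[ℝ] ℝ //
    ∀ p, ℓ p = ∑ i, inner2 (Φ i (p.1 i, p.2.1 i, tanAt p.2.2 i)) (incl (wn i))} :=
  ⟨fluxForm V Φ (fun i => incl (wn i)), fluxForm_apply V Φ (fun i => incl (wn i))⟩

variable {V}

/-- The left-hand side of the conservation equation, as a function of `ẑ^nor`. -/
def conservationL (wt : V × V) : {ℓ : Nb S →L[ℝ] ℝ //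
    ∀ zn, ℓ zn = ∑ i, inner2 (incl (zn i)) (incl (tanAt wt i))} :=
  ⟨(piPairing (fun i => inclL (S.Wnor i)) (fun _ => ContinuousLinearMap.id ℝ _)).flip
    (fun i => incl (tanAt wt i)), fun zn =>
      piPairing_apply (fun i => inclL (S.Wnor i)) (fun _ => ContinuousLinearMap.id ℝ _) zn
        (fun i => incl (tanAt wt i))⟩

end Semidiscrete

/-! ### Symmetry of the reduced vector field -/

section Reduced

variable {n : ℕ} {ι : Type*} [Fintype ι] {Ω : Set (Euc n)} {L : ι → Set (Euc n)} {S : Spaces L}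
  {Wt : Type*} [NormedAddCommGroup Wt] [InnerProductSpace ℝ Wt]
  {I : Set ℝ} {f : Source S} {Φ : Flux S} {Θ : ThetaMap S Wt Ω}

/-- Each half of the bracket is one conservation equation tested with the tangential trace of the
other pair. Such a test is admissible because both tangential traces are single-valued and vanish on
∂Ω. -/
theorem ConservationEq.sum_bracket_hatAt {n₁ n₂ : Nb S} (t₁ t₂ : Vring S Ω × Vring S Ω)
    (h₁ : ConservationEq Ω n₁) (h₂ : ConservationEq Ω n₂) :
    ∑ i, bracket (hatAt n₁ t₁ i) (hatAt n₂ t₂ i) = 0 := by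
  have e₁ : ∑ i, inner2 (incl (tanAt t₂ i)) (incl (n₁ i)) = 0 :=
    (Finset.sum_congr rfl fun i _ => inner2_comm _ _).trans (h₁ t₂)
  have e₂ : ∑ i, inner2 (incl (tanAt t₁ i)) (incl (n₂ i)) = 0 :=
    (Finset.sum_congr rfl fun i _ => inner2_comm _ _).trans (h₂ t₁)
  refine (Finset.sum_sub_distrib (fun i => inner2 (incl (tanAt t₁ i)) (incl (n₂ i)))
    (fun i => inner2 (incl (tanAt t₂ i)) (incl (n₁ i)))).trans ?_
  rw [e₁, e₂, sub_zero]

/-- The multisymplectic conservation law: the part of the residual that comes from `D` and from the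
numerical traces is symmetric on pairs of solutions of the flux and conservation equations. -/
theorem Multisymplectic.sum_symm (hΦ : Multisymplectic Ω Φ) {w₁ w₂ : Wb S} {n₁ n₂ : Nb S}
    {t₁ t₂ : Vring S Ω × Vring S Ω} (h₁ : FluxEq Φ w₁ n₁ t₁) (h₂ : FluxEq Φ w₂ n₂ t₂)
    (k₁ : ConservationEq Ω n₁) (k₂ : ConservationEq Ω n₂) :
    ∑ i, inner2 (form (w₁ i)) (dirac (w₂ i)) + ∑ i, bracket (hatAt n₁ t₁ i) (traces (w₂ i)) =
      ∑ i, inner2 (form (w₂ i)) (dirac (w₁ i)) +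
        ∑ i, bracket (hatAt n₂ t₂ i) (traces (w₁ i)) := by
  -- Multisymplecticity is stated on V̂^tan, whereas variations of Θ lie in V̊^tan. The inclusion
  -- leaves the underlying traces unchanged, so flux equations and brackets transfer definitionally.
  let inc : Vring S Ω × Vring S Ω → Vhat S Ω × Vhat S Ω := fun v =>
    (⟨v.1.1, v.1.2.1⟩, ⟨v.2.1, v.2.2.1⟩)
  have hm : ∀ i, bracket (hatAt n₁ t₁ i - traces (w₁ i)) (hatAt n₂ t₂ i - traces (w₂ i)) = 0 :=
    hΦ w₁ w₂ n₁ n₂ (inc t₁) (inc t₂) h₁ h₂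
  have hi : ∀ i, bracket (hatAt n₁ t₁ i) (hatAt n₂ t₂ i) =
      (inner2 (form (w₁ i)) (dirac (w₂ i)) + bracket (hatAt n₁ t₁ i) (traces (w₂ i))) -
        (inner2 (form (w₂ i)) (dirac (w₁ i)) + bracket (hatAt n₂ t₂ i) (traces (w₁ i))) := by
    intro i
    have e := (bracket_sub_sub (hatAt n₁ t₁ i) (traces (w₁ i)) (hatAt n₂ t₂ i)
      (traces (w₂ i))).symm.trans (hm i)
    have g := bracket_traces (w₁ i) (w₂ i)
    linarith
  have hc := (Finset.sum_congr rfl fun i _ => (hi i).symm).trans (k₁.sum_bracket_hatAt t₁ t₂ k₂)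
  rw [Finset.sum_sub_distrib, Finset.sum_add_distrib, Finset.sum_add_distrib] at hc
  exact sub_eq_zero.mp hc

theorem reducedField_contDiff_and_symmetric [CompleteSpace Wt]
    (hf : ∀ i, ∀ t ∈ I, ContDiff ℝ 1 (f i t)) (hΘ : ReductionAssumption Ω I f Φ Θ)
    (hΦ : Multisymplectic Ω Φ) (hsymm : SymmetricSource I f) {t : ℝ} (ht : t ∈ I) :
    ContDiff ℝ 1 (reducedField f Θ t) ∧ ∀ z w₁ w₂ : Wt × Wt,
      inner2 (fderiv ℝ (reducedField f Θ t) z w₁) w₂ =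
        inner2 w₁ (fderiv ℝ (reducedField f Θ t) z w₂) := by
  have hθ := hΘ.smooth t ht
  have hs : ContDiff ℝ 1 (sourceMap f t) := contDiff_pi.mpr fun i => (hf i t ht).comp
    (ContinuousLinearMap.proj (R := ℝ) (φ := fun i => S.W i × S.W i) i).contDiff
  have hR : ∀ z v, residual f t (Θ t z).1 (Θ t z).2.1 (Θ t z).2.2 v =
      (sourcePairing S).1 (sourceMap f t (Θ t z).1) v - (diracPairing S).1 (Θ t z).1 v -
        (bracketPairing S (Vring S Ω)).1 (Θ t z).2 v := fun z v =>
    (congrArg₂ (fun a b : ℝ => a - b) (congrArg₂ (fun a b : ℝ => a - b)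
      ((sourcePairing S).2 (sourceMap f t (Θ t z).1) v) ((diracPairing S).2 (Θ t z).1 v))
      ((bracketPairing S (Vring S Ω)).2 (Θ t z).2 v)).symm
  -- For each fixed test function the constraint is a bounded linear functional vanishing along Θ(t,
  -- ·), hence it annihilates the derivative. Linearity of Φ is essential here.
  have hflux : ∀ z w, FluxEq Φ (fderiv ℝ (Θ t) z w).1 (fderiv ℝ (Θ t) z w).2.1
      (fderiv ℝ (Θ t) z w).2.2 := fun z w wn =>
    ((fluxL (Vring S Ω) Φ wn).2 (fderiv ℝ (Θ t) z w)).symm.trans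
      (clm_fderiv_eq_zero (fluxL (Vring S Ω) Φ wn).1 hθ
        (fun y => ((fluxL (Vring S Ω) Φ wn).2 (Θ t y)).trans (hΘ.flux t ht y wn)) z w)
  have hcons : ∀ z w, ConservationEq Ω (fderiv ℝ (Θ t) z w).2.1 := fun z w wt =>
    ((conservationL wt).2 (fderiv ℝ (Θ t) z w).2.1).symm.trans
      (clm_fderiv_snd_fst_eq_zero (conservationL wt).1 hθ
        (fun y => ((conservationL wt).2 (Θ t y).2.1).trans (hΘ.conservation t ht y wt)) z w)
  have hsource : ∀ z u v : Wb S, (sourcePairing S).1 (fderiv ℝ (sourceMap f t) z u) v =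
      (sourcePairing S).1 (fderiv ℝ (sourceMap f t) z v) u := fun z u v =>
    ((sourcePairing S).2 _ v).trans ((hsymm t ht z u v).trans ((sourcePairing S).2 _ u).symm)
  have hpair : ∀ p q : Wb S × Nb S × (Vring S Ω × Vring S Ω),
      (diracPairing S).1 p.1 q.1 + (bracketPairing S (Vring S Ω)).1 p.2 q.1 =
        ∑ i, inner2 (form (p.1 i)) (dirac (q.1 i)) +
          ∑ i, bracket (hatAt p.2.1 p.2.2 i) (traces (q.1 i)) := fun p q =>
    congrArg₂ (fun a b : ℝ => a + b) ((diracPairing S).2 p.1 q.1)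
      ((bracketPairing S (Vring S Ω)).2 p.2 q.1)
  exact contDiff_and_symmetric_of_eq_bilinear (θ := Θ t) hR hs hθ (hΘ.smooth_fst t ht) hsource
    fun z w₁ w₂ => (hpair _ _).trans ((hΦ.sum_symm (hflux z w₁) (hflux z w₂) (hcons z w₁)
      (hcons z w₂)).trans (hpair _ _).symm)

end Reduced

end HybridFEEC

end

theorem mainTheorem12 {n : ℕ} {ι : Type*} [Fintype ι]
    (Ω : Set (HybridFEEC.Euc n)) (K : ι → Set (HybridFEEC.Euc n))
    (hK : HybridFEEC.IsLipschitzPartition Ω K)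
    (S : HybridFEEC.Spaces K)
    (I : Set ℝ) (hI : I.OrdConnected)
    (f : HybridFEEC.Source S) (hf : ∀ i, ∀ t ∈ I, ContDiff ℝ 1 (f i t))
    (Φ : HybridFEEC.Flux S)
    {Wt : Type*} [NormedAddCommGroup Wt] [InnerProductSpace ℝ Wt] [CompleteSpace Wt]
    (Θ : HybridFEEC.ThetaMap S Wt Ω)
    (hΘ : HybridFEEC.ReductionAssumption Ω I f Φ Θ)
    (hΦ : HybridFEEC.Multisymplectic Ω Φ)
    (hsymm : HybridFEEC.SymmetricSource I f) :
    (∀ t ∈ I, ContDiff ℝ 1 (HybridFEEC.reducedField f Θ t) ∧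
      ∀ z w₁ w₂ : Wt × Wt,
        HybridFEEC.inner2 (fderiv ℝ (HybridFEEC.reducedField f Θ t) z w₁) w₂ =
          HybridFEEC.inner2 w₁ (fderiv ℝ (HybridFEEC.reducedField f Θ t) z w₂)) ∧
    HybridFEEC.IsSymplecticODE I (HybridFEEC.reducedField f Θ) := by
  have h := fun t (ht : t ∈ I) => HybridFEEC.reducedField_contDiff_and_symmetric hf hΘ hΦ hsymm ht
  exact ⟨h, HybridFEEC.isSymplecticODE_of_symmetric fun t ht => (h t ht).2⟩
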